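/- Let $\mathfrak F$ be a commutative field with $\operatorname{char}\mathfrak F\neq 2$, let $\mathbb V$ be a nonzero finite-dimensional vector space over $\mathfrak F$ (with set of vectors $V$) and let $\eta$ be a nondegenerate alternating bilinear form on $\mathbb V$. On $\mathbb W=\mathfrak F\oplus\mathfrak F\oplus\mathbb V$ consider the nondegenerate symplectic form $$\xi([a_1,b_1,u_1],[a_2,b_2,u_2])=a_1b_2-a_2b_1+\eta(u_1,u_2),$$ and the polar space whose points and lines are the totally isotropic $1$- and $2$-dimensional subspaces of $\mathbb W$. Let $U=\langle 0,1,0\rangle$ and let $U^\perp$ be its polar hyperplane. The symplectic affine polar space $\mathfrak U$ is the restriction of this polar space to the complement of $U^\perp$: its points are the points of the polar space not contained in $U^\perp$, and its lines are the lines of the polar space not contained in $U^\perp$, with their points in $U^\perp$ deleted. Its point set is identified with $Y=\mathfrak F\times V$ by letting $[a,u]\in Y$ correspond to the subspace $\langle 1,a,u\rangle$. For $[a_1,u_1],[a_2,u_2]\in Y$ set $$\rho([a_1,u_1],[a_2,u_2])=\eta(u_1,u_2)-(a_1-a_2),$$ and for $p_1,p_2,p_3,p_4\in Y$ write $p_1p_2\equiv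 p_3p_4$ iff $\rho(p_1,p_2)=\rho(p_3,p_4)$. Let $f\colon Y\to Y$ be an arbitrary map. Then the following conditions are equivalent. 1. $f$ is an automorphism of $\langle Y,\equiv\rangle$, i.e. $f$ is a bijection such that for all $p_1,\dots,p_4\in Y$: $p_1p_2\equiv p_3p_4$ iff $f(p_1)f(p_2)\equiv f(p_3)f(p_4)$. 2. $f$ is an automorphism of $\mathfrak U$, i.e. $f$ is a bijection of $Y$ such that a set $\ell\subseteq Y$ is a line of $\mathfrak U$ iff $f(\ell)$ is a line of $\mathfrak U$. 3. There are a scalar $\alpha\neq 0$ and a field automorphism $\sigma$ of $\mathfrak F$ such that $\rho(f(p_1),f(p_2))=\alpha\,\sigma(\rho(p_1,p_2))$ for all $p_1,p_2\in Y$. -/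

import Mathlib

noncomputable section

namespace SymplecticAps

universe u v w

section Polar

variable {F : Type u} [Field F] {W : Type w} [AddCommGroup W] [Module F W]

/-- The totally isotropic `k`-dimensional subspaces of `W` with respect to `ξ`.
The points of the polar space of `ξ` are the members for `k = 1`,
its lines are the members for `k = 2`, and incidence is inclusion. -/
def isotropicSubspaces (ξ : LinearMap.BilinForm F W) (k : ℕ) : Set (Submodule F W) :=
  {S | (∀ x ∈ S, ∀ y ∈ S, ξ x y = 0) ∧ Module.finrank F S = k}

/-- Points of the affine polar space derived from the polar space of `ξ` and its point `U`:
the points of the polar space that do not lie on the polar hyperplane of `U`. -/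
def affinePolarPoints (ξ : LinearMap.BilinForm F W) (U : Submodule F W) :
    Set (Submodule F W) :=
  {P | P ∈ isotropicSubspaces ξ 1 ∧ ¬ P ≤ ξ.orthogonal U}

/-- Lines of the affine polar space derived from the polar space of `ξ` and its point `U`,
as sets of points: the traces on the affine point set of those lines of the polar space
that are not contained in the polar hyperplane of `U`. -/
def affinePolarLines (ξ : LinearMap.BilinForm F W) (U : Submodule F W) :
    Set (Set (Submodule F W)) :=
  {l | ∃ L ∈ isotropicSubspaces ξ 2, ¬ L ≤ ξ.orthogonal U ∧
    l = {P | P ∈ affinePolarPoints ξ U ∧ P ≤ L}}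

end Polar

section Symplectic

variable {F : Type u} [Field F] {V : Type v} [AddCommGroup V] [Module F V]

/-- The form `ξ([a₁, b₁, u₁], [a₂, b₂, u₂]) = a₁ b₂ - a₂ b₁ + η(u₁, u₂)`
on `W = F ⊕ F ⊕ V`. -/
def formW (η : LinearMap.BilinForm F V) : LinearMap.BilinForm F (F × F × V) :=
  LinearMap.mk₂ F (fun x y => x.1 * y.2.1 - y.1 * x.2.1 + η x.2.2 y.2.2)
    (by intro x x' y; simp; ring)
    (by intro c x y; simp; ring)
    (by intro x y y'; simp; ring)
    (by intro c x y; simp; ring)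

/-- The distinguished point `⟨0, 1, 0⟩` of the polar space of `formW η`. -/
def pointU (F : Type u) [Field F] (V : Type v) [AddCommGroup V] [Module F V] :
    Submodule F (F × F × V) :=
  Submodule.span F {((0 : F), (1 : F), (0 : V))}

/-- The identification of the vector `[a, u]` of `Y = F ⊕ V` with the projective point
`⟨1, a, u⟩`. -/
def toPoint (p : F × V) : Submodule F (F × F × V) :=
  Submodule.span F {((1 : F), p.1, p.2)}

theorem mem_orthogonal_pointU (η : LinearMap.BilinForm F V) (x : F × F × V) :
    x ∈ (formW η).orthogonal (pointU F V) ↔ x.1 = 0 := by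
  rw [LinearMap.BilinForm.mem_orthogonal_iff]
  constructor
  · intro h
    have := h (0, 1, 0) (Submodule.mem_span_singleton_self _)
    simpa [formW] using this
  · intro h n hn
    obtain ⟨c, rfl⟩ := Submodule.mem_span_singleton.1 hn
    simp [formW, h]

/-- For an alternating form, `toPoint` is a bijection from `Y = F ⊕ V` onto the point set
of the affine polar space. -/
theorem toPoint_bijOn (η : LinearMap.BilinForm F V) (hη : η.IsAlt) :
    Set.BijOn toPoint Set.univ (affinePolarPoints (formW η) (pointU F V)) := by
  refine ⟨?_, ?_, ?_⟩
  · rintro p -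
    refine ⟨⟨?_, ?_⟩, ?_⟩
    · intro x hx y hy
      obtain ⟨c, rfl⟩ := Submodule.mem_span_singleton.1 hx
      obtain ⟨d, rfl⟩ := Submodule.mem_span_singleton.1 hy
      have h0 : η p.2 p.2 = 0 := hη p.2
      simp [formW, h0]
      ring
    · exact finrank_span_singleton (by simp)
    · intro h
      have := (mem_orthogonal_pointU η _).1 (h (Submodule.mem_span_singleton_self _))
      simp at this
  · rintro p - q - h
    have hp : ((1 : F), p.1, p.2) ∈ toPoint q := by
      rw [← h]; exact Submodule.mem_span_singleton_self _
    obtain ⟨c, hc⟩ := Submodule.mem_span_singleton.1 hp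
    simp only [Prod.smul_mk, Prod.mk.injEq, smul_eq_mul, mul_one] at hc
    obtain ⟨rfl, h1, h2⟩ := hc
    ext
    · simpa using h1.symm
    · simpa using h2.symm
  · rintro P ⟨⟨-, hP⟩, hU⟩
    obtain ⟨x, hxP, hx⟩ := SetLike.not_le_iff_exists.1 hU
    rw [mem_orthogonal_pointU] at hx
    refine ⟨(x.1⁻¹ * x.2.1, x.1⁻¹ • x.2.2), Set.mem_univ _, ?_⟩
    have hy : ((1 : F), x.1⁻¹ * x.2.1, x.1⁻¹ • x.2.2) = x.1⁻¹ • x := by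
      ext <;> simp [hx]
    have hfd : FiniteDimensional F P := Module.finite_of_finrank_pos (by omega)
    refine Submodule.eq_of_le_of_finrank_eq ?_ ?_
    · rw [toPoint, Submodule.span_singleton_le_iff_mem, hy]
      exact P.smul_mem _ hxP
    · rw [hP]
      exact finrank_span_singleton (by simp)

/-- The lines of the affine polar space `𝔘` derived from the polar space of `formW η` and
its point `⟨0, 1, 0⟩`, as subsets of `Y = F ⊕ V`, under the identification `toPoint`. -/
def lines (η : LinearMap.BilinForm F V) : Set (Set (F × V)) :=
  {l | toPoint '' l ∈ affinePolarLines (formW η) (pointU F V)}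

/-- `f` is an automorphism of the point-line structure `𝔘`: a bijection of the point set
under which a set of points is a line iff its image is a line. -/
def IsAutAps (η : LinearMap.BilinForm F V) (f : F × V → F × V) : Prop :=
  Function.Bijective f ∧ ∀ l : Set (F × V), l ∈ lines η ↔ f '' l ∈ lines η

/-- `ρ([a₁, u₁], [a₂, u₂]) = η(u₁, u₂) - (a₁ - a₂)`. -/
def rho (η : LinearMap.BilinForm F V) (p q : F × V) : F :=
  η p.2 q.2 - (p.1 - q.1)

/-- `p₁p₂ ≡ p₃p₄`. -/
def Equidist (η : LinearMap.BilinForm F V) (p₁ p₂ p₃ p₄ : F × V) : Prop :=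
  rho η p₁ p₂ = rho η p₃ p₄

/-- `f` is an automorphism of the relational structure `⟨Y, ≡⟩`. -/
def IsAutEquidist (η : LinearMap.BilinForm F V) (f : F × V → F × V) : Prop :=
  Function.Bijective f ∧ ∀ p₁ p₂ p₃ p₄ : F × V,
    Equidist η p₁ p₂ p₃ p₄ ↔ Equidist η (f p₁) (f p₂) (f p₃) (f p₄)

end Symplectic

end SymplecticAps

end

namespace SymplecticAps

universe u v

/-! ### The form ρ and Heisenberg translations -/

section Rho

variable {F : Type u} [Field F] {V : Type v} [AddCommGroup V] [Module F V]
  {η : LinearMap.BilinForm F V}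

/-! Conditions 1 and 2 each make `f` a bijection preserving the relation ρ = 0 both ways: ρ(p,p) = 0
turns pq ≡ pp into ρ(p,q) = 0, and ρ(p,q) = 0 means equal or collinear (`rho_eq_zero_iff`). This
relation alone forces condition 3 (`exists_rho_eq_of_neighbours`). After a translation `f` fixes 0.
Having no common neighbour singles out distinct points of one fibre over `V`, so `f` splits as (a,
u) ↦ (φ a, g u) with η(gu, gv) = φ(η(u,v)), and bilinearity makes φ a multiple of a field
automorphism. Conversely, condition 3 gives bijectivity by nondegeneracy and finite dimension. Since
ρ is affine in each argument and separates points, `f` then maps affine lines to affine lines. -/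

theorem rho_self (hη : η.IsAlt) (p : F × V) : rho η p p = 0 := by
  simp [rho, hη p.2]

theorem rho_swap (hη : η.IsAlt) (p q : F × V) : rho η q p = -rho η p q := by
  simp only [rho, ← LinearMap.IsAlt.neg hη p.2 q.2]
  ring

theorem rho_lineMap_left (η : LinearMap.BilinForm F V) (p q r : F × V) (t : F) :
    rho η (AffineMap.lineMap p q t) r = AffineMap.lineMap (rho η p r) (rho η q r) t := by
  simp [rho, AffineMap.lineMap_apply]
  ring

theorem rho_zero_left (η : LinearMap.BilinForm F V) (p : F × V) : rho η 0 p = p.1 := by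
  simp [rho]

/-- Points with the same `ρ`-distances to all points are equal. -/
theorem eq_of_forall_rho_eq (hη' : η.Nondegenerate) {p q : F × V}
    (h : ∀ r, rho η p r = rho η q r) : p = q := by
  have h1 : p.1 = q.1 := by simpa [rho] using h 0
  refine Prod.ext h1 (sub_eq_zero.1 (hη'.1 _ fun v => ?_))
  have := h (0, v)
  simp only [rho, h1, sub_zero, sub_left_inj] at this
  simp [this]

theorem exists_form_eq (hη' : η.Nondegenerate) {u : V} (hu : u ≠ 0) (a : F) :
    ∃ v, η u v = a := by
  by_contra! h
  refine hu (hη'.1 u fun v => ?_)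
  by_contra hv
  exact h ((a * (η u v)⁻¹) • v) (by simp [hv])

/-- Two points with different second components have a common `ρ`-neighbour, while distinct
points with the same second component have none. -/
theorem exists_common_neighbour_iff (hη : η.IsAlt) (hη' : η.Nondegenerate) (p q : F × V) :
    (∃ r, rho η p r = 0 ∧ rho η q r = 0) ↔ p = q ∨ p.2 ≠ q.2 := by
  constructor
  · rintro ⟨r, hp, hq⟩
    by_contra! h
    refine h.1 (Prod.ext ?_ h.2)
    simp only [rho, h.2] at hp hq
    linear_combination hq - hp
  · rintro (rfl | h)
    · exact ⟨p, rho_self hη p, rho_self hη p⟩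
    · obtain ⟨w, hw⟩ := exists_form_eq hη' (sub_ne_zero.2 h) (p.1 - q.1)
      refine ⟨(p.1 - η p.2 w, w), by simp [rho], ?_⟩
      simp only [map_sub, LinearMap.sub_apply] at hw
      simp only [rho]
      linear_combination -hw

/-- The Heisenberg translation of `Y` that maps `0` to `c`. -/
def shift (η : LinearMap.BilinForm F V) (c p : F × V) : F × V :=
  (p.1 + c.1 - η c.2 p.2, p.2 + c.2)

/-- The twist in the first coordinate cancels the cross terms of η. Composing with a translation
therefore reduces to maps fixing 0. -/
theorem rho_shift (hη : η.IsAlt) (c p q : F × V) :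
    rho η (shift η c p) (shift η c q) = rho η p q := by
  have h0 : η c.2 c.2 = 0 := hη c.2
  simp only [rho, shift, map_add, LinearMap.add_apply, ← LinearMap.IsAlt.neg hη p.2 c.2, h0]
  ring

theorem shift_neg_shift (hη : η.IsAlt) (c p : F × V) : shift η (-c) (shift η c p) = p := by
  have h0 : η c.2 c.2 = 0 := hη c.2
  ext
  · simp [shift, h0]
    ring
  · simp [shift]

theorem shift_bijective (hη : η.IsAlt) (c : F × V) : Function.Bijective (shift η c) :=
  Function.bijective_iff_has_inverse.2 ⟨shift η (-c), shift_neg_shift hη c, fun p => by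
    simpa using shift_neg_shift hη (-c) p⟩

theorem shift_neg_self (hη : η.IsAlt) (c : F × V) : shift η (-c) c = 0 := by
  have h0 : η c.2 c.2 = 0 := hη c.2
  ext <;> simp [shift, h0]

end Rho

/-! ### Semisimilitudes are bijective -/

section Similitude

variable {F : Type u} [Field F] {V : Type v} [AddCommGroup V] [Module F V]
  {η : LinearMap.BilinForm F V}

/-- A map of a finite-dimensional space that transforms a nondegenerate form by a field
automorphism and a nonzero factor is onto. -/
theorem surjective_of_semisimilitude [FiniteDimensional F V] (hη' : η.Nondegenerate)
    {g : V → V} {α : F} (hα : α ≠ 0) (σ : F ≃+* F)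
    (hg : ∀ u v, η (g u) (g v) = α * σ (η u v)) : Function.Surjective g := by
  classical
  let b := Module.finBasis F V
  let d := η.dualBasis hη' b
  -- `g` is not known to be additive; independence of the g(dᵢ) comes from pairing them with the
  -- g(bⱼ).
  have hd : ∀ i j, η (g (d i)) (g (b j)) = if j = i then α else 0 := fun i j => by
    rw [hg, LinearMap.BilinForm.apply_dualBasis_left]
    split_ifs <;> simp
  have hli : LinearIndependent F (fun i => g (d i)) := by
    rw [Fintype.linearIndependent_iff]
    intro c hc i
    have := congrArg (fun x => η x (g (b i))) hc
    simpa [hd, hα] using this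
  have hspan : ⊤ ≤ Submodule.span F (Set.range fun i => g (d i)) :=
    (hli.span_eq_top_of_card_eq_finrank' (by simp)).ge
  let e := Module.Basis.mk hli hspan
  have he : ∀ i, e i = g (d i) := fun i => Module.Basis.mk_apply hli hspan i
  intro x
  -- The coordinates of x in the basis g(dᵢ), untwisted by σ: the image of this vector and x have
  -- equal pairings with that basis.
  refine ⟨∑ i, σ.symm (e.repr x i) • d i, sub_eq_zero.1 (hη'.2 _ fun y => ?_)⟩
  have key : ∀ i, η (e i) (g (∑ i, σ.symm (e.repr x i) • d i) - x) = 0 := fun i => by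
    rw [map_sub, he, hg, sub_eq_zero]
    conv_rhs => rw [← e.sum_repr x]
    simp [he, hg, Finset.mul_sum]
    exact Finset.sum_congr rfl fun j _ => by ring
  exact LinearMap.congr_fun (e.ext (f₁ := η.flip _) (f₂ := 0) key) y

/-- A map transforming `ρ` by a field automorphism and a nonzero factor is bijective. -/
theorem bijective_of_rho_eq [FiniteDimensional F V] (hη : η.IsAlt) (hη' : η.Nondegenerate)
    {f : F × V → F × V} {α : F} (hα : α ≠ 0) (σ : F ≃+* F)
    (hf : ∀ p q, rho η (f p) (f q) = α * σ (rho η p q)) : Function.Bijective f := by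
  refine ⟨fun p q h => eq_of_forall_rho_eq hη' fun r => ?_, ?_⟩
  · have := hf p r
    rw [h, hf q r] at this
    exact (σ.injective (mul_left_cancel₀ hα this)).symm
  · set f' := shift η (-f 0) ∘ f with hf'
    have hρ : ∀ p q, rho η (f' p) (f' q) = α * σ (rho η p q) := fun p q => by
      rw [← hf, hf', Function.comp_apply, Function.comp_apply, rho_shift hη]
    have h0 : f' 0 = 0 := shift_neg_self hη _
    have h1 : ∀ p, (f' p).1 = α * σ p.1 := fun p => by
      rw [← rho_zero_left η, ← h0, hρ, rho_zero_left]
    have h2 : ∀ p q, η (f' p).2 (f' q).2 = α * σ (η p.2 q.2) := fun p q => by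
      have := hρ p q
      simp only [rho, h1, map_sub] at this
      linear_combination this
    refine (Function.Surjective.of_comp_iff' (shift_bijective hη (-f 0)) f).1 ?_
    have hg := surjective_of_semisimilitude hη' hα σ (g := fun u => (f' (0, u)).2)
      fun u v => h2 (0, u) (0, v)
    rintro ⟨a, x⟩
    obtain ⟨u, hu⟩ := hg x
    refine ⟨(σ.symm (α⁻¹ * a), u), Prod.ext ((h1 _).trans (by simp [hα])) ?_⟩
    -- The second component might still depend on the first coordinate; testing against all g(v),
    -- which exhaust `V`, excludes this.
    refine sub_eq_zero.1 (hη'.1 _ fun y => ?_)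
    obtain ⟨v, rfl⟩ := hg y
    simp only [← hu, map_sub, LinearMap.sub_apply]
    rw [← hf', h2, h2, sub_self]

end Similitude

/-! ### From the relation ρ = 0 to a field automorphism -/

section Neighbours

variable {F : Type u} [Field F] {V : Type v} [AddCommGroup V] [Module F V]
  {η : LinearMap.BilinForm F V}

/-- A bijection fixing `0` and preserving the relation `ρ = 0` is a direct product of an additive
bijection `φ` of the field and a map of `V` transforming `η` by `φ`. -/
theorem exists_product_form [Nontrivial V] (hη : η.IsAlt) (hη' : η.Nondegenerate)
    {f : F × V → F × V} (hf : Function.Bijective f) (h0 : f 0 = 0)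
    (hρ : ∀ p q, rho η p q = 0 ↔ rho η (f p) (f q) = 0) :
    ∃ (φ : F ≃+ F) (g : V → V), Function.Surjective g ∧ (∀ a u, f (a, u) = (φ a, g u)) ∧
      ∀ u v, η (g u) (g v) = φ (η u v) := by
  have hver : ∀ p q : F × V, p.2 = q.2 ↔ (f p).2 = (f q).2 := fun p q => by
    have h := exists_common_neighbour_iff hη hη' p q
    have h' := exists_common_neighbour_iff hη hη' (f p) (f q)
    rw [hf.2.exists (p := fun r => rho η (f p) r = 0 ∧ rho η (f q) r = 0)] at h'
    simp only [← hρ, h, hf.1.eq_iff] at h'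
    by_cases hpq : p = q
    · simp [hpq]
    · simpa [hpq, not_iff_not] using h'
  set φ : F → F := fun a => (f (a, 0)).1 with hφ
  set g : V → V := fun u => (f (0, u)).2 with hg
  have hφ0 : ∀ a, f (a, 0) = (φ a, 0) := fun a => by
    refine Prod.ext rfl ?_
    have := (hver (a, 0) 0).1 rfl
    rwa [h0] at this
  have hfg : ∀ a u, f (a, u) = (φ a, g u) := fun a u => by
    refine Prod.ext ?_ ((hver (a, u) (0, u)).1 rfl)
    -- (a, 0) and (a, u) are neighbours, which carries the first coordinate across fibres.
    have := (hρ (a, 0) (a, u)).1 (by simp [rho])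
    rw [hφ0] at this
    simp only [rho, map_zero, LinearMap.zero_apply, zero_sub, neg_eq_zero, sub_eq_zero] at this
    exact this.symm
  have hz : φ 0 = 0 := congrArg Prod.fst h0
  have hsub' : ∀ u v a b, η u v = a - b → η (g u) (g v) = φ a - φ b := fun u v a b h => by
    have := (hρ (a, u) (b, v)).1 (by simp [rho, h])
    rwa [hfg, hfg, rho, sub_eq_zero] at this
  have hηφ : ∀ u v, η (g u) (g v) = φ (η u v) := fun u v => by
    simpa [hz] using hsub' u v (η u v) 0 (by simp)
  obtain ⟨u, hu⟩ := exists_ne (0 : V)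
  have hsub : ∀ a b, φ (a - b) = φ a - φ b := fun a b => by
    obtain ⟨v, hv⟩ := exists_form_eq hη' hu (a - b)
    rw [← hsub' u v a b hv, hηφ, hv]
  have hbij : Function.Bijective φ := by
    refine ⟨fun a b h => ?_, fun a => ?_⟩
    · have := hf.1 (show f (a, 0) = f (b, 0) by rw [hφ0, hφ0, h])
      exact congrArg Prod.fst this
    · obtain ⟨⟨b, v⟩, hb⟩ := hf.2 (a, 0)
      exact ⟨b, by rw [hfg] at hb; exact congrArg Prod.fst hb⟩
  let φ' : F →+ F := AddMonoidHom.ofMapSub φ hsub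
  refine ⟨AddEquiv.ofBijective φ' hbij, g, fun x => ?_, hfg, hηφ⟩
  obtain ⟨⟨b, v⟩, hb⟩ := hf.2 (0, x)
  exact ⟨v, by rw [hfg] at hb; exact congrArg Prod.snd hb⟩

/-- An additive bijection transforming a nonzero form is a scalar multiple of a field
automorphism. -/
theorem exists_ringEquiv_of_form [Nontrivial V] (hη' : η.Nondegenerate)
    (φ : F ≃+ F) {g : V → V} (hg : Function.Surjective g)
    (hηφ : ∀ u v, η (g u) (g v) = φ (η u v)) :
    ∃ (α : F) (σ : F ≃+* F), α ≠ 0 ∧ ∀ x, φ x = α * σ x := by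
  have h1 : φ 1 ≠ 0 := by simp
  obtain ⟨u, hu⟩ := exists_ne (0 : V)
  have hmul : ∀ t x, φ (t * x) * φ 1 = φ t * φ x := fun t x => by
    obtain ⟨v₀, hv₀⟩ := exists_form_eq hη' hu 1
    obtain ⟨v, hv⟩ := exists_form_eq hη' hu x
    -- Chosen so that g(w) is orthogonal to g(u). Then w is orthogonal to u, hence to t • u, and
    -- expanding η(g(t • u), g(w)) = 0 gives the identity.
    obtain ⟨w, hw⟩ := hg (φ 1 • g v - φ x • g v₀)
    have hw0 : η u w = 0 := by
      have := hηφ u w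
      rw [hw, map_sub, map_smul, map_smul, hηφ, hηφ, hv, hv₀, smul_eq_mul, smul_eq_mul,
        mul_comm, sub_self] at this
      simpa using this.symm
    have := hηφ (t • u) w
    rw [hw, map_sub, map_smul, map_smul, hηφ, hηφ, map_smul, LinearMap.smul_apply,
      LinearMap.smul_apply, LinearMap.smul_apply, hv, hv₀, hw0] at this
    simp only [smul_eq_mul, mul_one, mul_zero, map_zero] at this
    linear_combination this
  let σ : F →+* F :=
    { toFun := fun x => φ x / φ 1
      map_one' := div_self h1
      map_mul' := fun x y => by
        field_simp
        exact hmul x y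
      map_zero' := by simp
      map_add' := fun x y => by rw [map_add, add_div] }
  have hσ : ∀ x, φ x = φ 1 * σ x := fun x => (mul_div_cancel₀ (φ x) h1).symm
  have hsurj : Function.Surjective σ := fun y => by
    obtain ⟨x, hx⟩ := φ.surjective (φ 1 * y)
    exact ⟨x, mul_left_cancel₀ h1 (by rw [← hσ, hx])⟩
  exact ⟨φ 1, RingEquiv.ofBijective σ ⟨σ.injective, hsurj⟩, h1, hσ⟩

/-- A bijection that preserves the relation `ρ = 0` in both directions transforms `ρ` by a
field automorphism and a nonzero factor. -/
theorem exists_rho_eq_of_neighbours [Nontrivial V] (hη : η.IsAlt) (hη' : η.Nondegenerate)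
    {f : F × V → F × V} (hf : Function.Bijective f)
    (hρ : ∀ p q, rho η p q = 0 ↔ rho η (f p) (f q) = 0) :
    ∃ (α : F) (σ : F ≃+* F), α ≠ 0 ∧ ∀ p q, rho η (f p) (f q) = α * σ (rho η p q) := by
  obtain ⟨φ, g, hg, hfg, hηφ⟩ := exists_product_form hη hη'
    (f := shift η (-f 0) ∘ f) ((shift_bijective hη _).comp hf) (shift_neg_self hη _)
    fun p q => by rw [hρ, Function.comp_apply, Function.comp_apply, rho_shift hη]
  obtain ⟨α, σ, hα, hφ⟩ := exists_ringEquiv_of_form hη' φ hg hηφ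
  refine ⟨α, σ, hα, fun p q => ?_⟩
  have hp := hfg p.1 p.2
  have hq := hfg q.1 q.2
  simp only [Prod.mk.eta, Function.comp_apply] at hp hq
  rw [← rho_shift hη (-f 0), hp, hq, ← hφ]
  simp only [rho, hηφ, map_sub]

end Neighbours

/-! ### Lines of the affine polar space -/

section Lines

variable {F : Type u} [Field F] {V : Type v} [AddCommGroup V] [Module F V]
  {η : LinearMap.BilinForm F V}

theorem toPoint_le_iff (p : F × V) (L : Submodule F (F × F × V)) :
    toPoint p ≤ L ↔ ((1 : F), p) ∈ L :=
  Submodule.span_singleton_le_iff_mem _ _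

theorem formW_one (η : LinearMap.BilinForm F V) (p q : F × V) :
    formW η (1, p) (1, q) = rho η p q := by
  simp [formW, rho]
  ring

/-- An affine point spans a unique vector with first coordinate 1, so a line is the slice of its
plane at height 1. -/
theorem mem_lines_iff_exists_submodule (hη : η.IsAlt) (l : Set (F × V)) :
    l ∈ lines η ↔ ∃ L ∈ isotropicSubspaces (formW η) 2,
      ¬ L ≤ (formW η).orthogonal (pointU F V) ∧ l = {p | ((1 : F), p) ∈ L} := by
  have hb := toPoint_bijOn η hη
  have hinj : Function.Injective (toPoint : F × V → Submodule F (F × F × V)) :=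
    Set.injOn_univ.1 hb.injOn
  have himg : ∀ L : Submodule F (F × F × V),
      {P | P ∈ affinePolarPoints (formW η) (pointU F V) ∧ P ≤ L} =
        toPoint '' {p | ((1 : F), p) ∈ L} := fun L => by
    rw [← hb.image_eq]
    ext P
    constructor
    · rintro ⟨⟨p, -, rfl⟩, hp⟩
      exact ⟨p, (toPoint_le_iff p L).1 hp, rfl⟩
    · rintro ⟨p, hp, rfl⟩
      exact ⟨⟨p, Set.mem_univ _, rfl⟩, (toPoint_le_iff p L).2 hp⟩
  simp only [lines, affinePolarLines, Set.mem_ofPred_eq, himg, hinj.image_injective.eq_iff]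

theorem finrank_span_one_pair {p q : F × V} (hpq : p ≠ q) :
    Module.finrank F (Submodule.span F {((1 : F), p), ((1 : F), q)}) = 2 := by
  have hli : LinearIndependent F ![((1 : F), p), ((1 : F), q)] := by
    rw [LinearIndependent.pair_iff]
    intro s t h
    simp only [Prod.smul_mk, Prod.mk_add_mk, smul_eq_mul, mul_one, Prod.mk_eq_zero] at h
    obtain ⟨h1, h2⟩ := h
    have hs : s = -t := by linear_combination h1
    subst hs
    rw [neg_smul, neg_add_eq_sub, ← smul_sub, smul_eq_zero, sub_eq_zero] at h2
    have := h2.resolve_right hpq.symm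
    simp [this]
  have := finrank_span_eq_card hli
  rwa [Matrix.range_cons_cons_empty, Fintype.card_fin] at this

theorem one_mem_span_pair_iff (p q r : F × V) :
    ((1 : F), r) ∈ Submodule.span F {((1 : F), p), ((1 : F), q)} ↔
      r ∈ Set.range (AffineMap.lineMap p q : F → F × V) := by
  rw [Submodule.mem_span_pair]
  simp only [Prod.smul_mk, Prod.mk_add_mk, smul_eq_mul, mul_one, Prod.mk.injEq, Set.mem_range,
    AffineMap.lineMap_apply_module]
  constructor
  · rintro ⟨a, b, h, rfl⟩
    exact ⟨b, by rw [← h, add_sub_cancel_right]⟩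
  · rintro ⟨t, rfl⟩
    exact ⟨1 - t, t, by ring, rfl⟩

/-- The lines of the affine polar space are the affine lines joining two distinct points
with `ρ = 0`. -/
theorem mem_lines_iff (hη : η.IsAlt) (l : Set (F × V)) :
    l ∈ lines η ↔ ∃ p q, p ≠ q ∧ rho η p q = 0 ∧
      l = Set.range (AffineMap.lineMap p q : F → F × V) := by
  rw [mem_lines_iff_exists_submodule hη]
  constructor
  · rintro ⟨L, ⟨hiso, hL⟩, hU, rfl⟩
    have hfd : FiniteDimensional F L := Module.finite_of_finrank_pos (by omega)
    obtain ⟨x, hxL, hx⟩ := SetLike.not_le_iff_exists.1 hU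
    rw [mem_orthogonal_pointU] at hx
    obtain ⟨p, hp⟩ : ∃ p, ((1 : F), p) ∈ L := by
      refine ⟨x.1⁻¹ • x.2, ?_⟩
      have := L.smul_mem x.1⁻¹ hxL
      rwa [show x.1⁻¹ • x = ((1 : F), x.1⁻¹ • x.2) from Prod.ext (by simp [hx]) rfl] at this
    obtain ⟨y, hyL, hy⟩ : ∃ y ∈ L, y ∉ Submodule.span F {((1 : F), p)} := by
      by_contra! h
      have h1 := Submodule.finrank_mono (show L ≤ Submodule.span F {((1 : F), p)} from h)
      rw [hL, finrank_span_singleton (by simp)] at h1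
      omega
    -- y may have first coordinate 0; removing its height along (1, p) and adding (1, p) gives a
    -- second point at height 1.
    have hqL : ((1 : F), p + (y.2 - y.1 • p)) ∈ L := by
      have := L.add_mem hp (L.sub_mem hyL (L.smul_mem y.1 hp))
      rwa [show ((1 : F), p) + (y - y.1 • ((1 : F), p)) = ((1 : F), p + (y.2 - y.1 • p)) from
        Prod.ext (by simp) (by simp)] at this
    have hpq : p ≠ p + (y.2 - y.1 • p) := fun h => by
      refine hy (Submodule.mem_span_singleton.2 ⟨y.1, Prod.ext (by simp) ?_⟩)
      exact (sub_eq_zero.1 (left_eq_add.1 h)).symm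
    refine ⟨p, p + (y.2 - y.1 • p), hpq, by rw [← formW_one]; exact hiso _ hp _ hqL, ?_⟩
    ext r
    rw [← one_mem_span_pair_iff, Submodule.eq_of_le_of_finrank_eq
      (Submodule.span_le.2 (Set.pair_subset hp hqL)) ((finrank_span_one_pair hpq).trans hL.symm)]
    rfl
  · rintro ⟨p, q, hpq, h, rfl⟩
    refine ⟨Submodule.span F {((1 : F), p), ((1 : F), q)}, ⟨?_, finrank_span_one_pair hpq⟩, ?_, ?_⟩
    · intro x hx y hy
      obtain ⟨a, b, rfl⟩ := Submodule.mem_span_pair.1 hx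
      obtain ⟨c, d, rfl⟩ := Submodule.mem_span_pair.1 hy
      simp only [map_add, map_smul, LinearMap.add_apply, LinearMap.smul_apply, formW_one,
        rho_self hη, rho_swap hη p q, h]
      simp
    · intro hle
      have := (mem_orthogonal_pointU η _).1
        (hle (Submodule.subset_span (Set.mem_insert ((1 : F), p) _)))
      exact one_ne_zero this
    · ext r
      exact (one_mem_span_pair_iff p q r).symm

/-- Two points are `ρ`-neighbours iff they coincide or are joined by a line. -/
theorem rho_eq_zero_iff (hη : η.IsAlt) (p q : F × V) :
    rho η p q = 0 ↔ p = q ∨ ∃ l ∈ lines η, p ∈ l ∧ q ∈ l := by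
  constructor
  · intro h
    by_cases hpq : p = q
    · exact Or.inl hpq
    · exact Or.inr ⟨_, (mem_lines_iff hη _).2 ⟨p, q, hpq, h, rfl⟩,
        ⟨0, AffineMap.lineMap_apply_zero _ _⟩, ⟨1, AffineMap.lineMap_apply_one _ _⟩⟩
  · rintro (rfl | ⟨l, hl, hp, hq⟩)
    · exact rho_self hη p
    · obtain ⟨L, ⟨hiso, -⟩, -, rfl⟩ := (mem_lines_iff_exists_submodule hη l).1 hl
      rw [← formW_one]
      exact hiso _ hp _ hq

/-- An automorphism of the affine polar space preserves the relation `ρ = 0`. -/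
theorem IsAutAps.rho_eq_zero_iff (hη : η.IsAlt) {f : F × V → F × V} (hf : IsAutAps η f)
    (p q : F × V) : rho η p q = 0 ↔ rho η (f p) (f q) = 0 := by
  rw [SymplecticAps.rho_eq_zero_iff hη, SymplecticAps.rho_eq_zero_iff hη, hf.1.1.eq_iff,
    hf.1.2.image_surjective.exists (p := fun l => l ∈ lines η ∧ f p ∈ l ∧ f q ∈ l)]
  simp only [← hf.2, hf.1.1.mem_set_image]

/-- A map transforming `ρ` by a field automorphism and a nonzero factor preserves lines in both
directions. -/
theorem isAutAps_of_rho_eq [FiniteDimensional F V] (hη : η.IsAlt) (hη' : η.Nondegenerate)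
    {f : F × V → F × V} {α : F} (hα : α ≠ 0) (σ : F ≃+* F)
    (hf : ∀ p q, rho η (f p) (f q) = α * σ (rho η p q)) : IsAutAps η f := by
  have hbij := bijective_of_rho_eq hη hη' hα σ hf
  have hline : ∀ p q t, f (AffineMap.lineMap p q t) = AffineMap.lineMap (f p) (f q) (σ t) :=
    fun p q t => eq_of_forall_rho_eq hη' fun r => by
      obtain ⟨s, rfl⟩ := hbij.2 r
      rw [rho_lineMap_left, hf, hf, hf, rho_lineMap_left]
      simp only [AffineMap.lineMap_apply_module, smul_eq_mul, map_add, map_mul, map_sub, map_one]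
      ring
  have himg : ∀ p q, f '' Set.range (AffineMap.lineMap p q : F → F × V) =
      Set.range (AffineMap.lineMap (f p) (f q) : F → F × V) := fun p q => by
    rw [← Set.range_comp, ← σ.surjective.range_comp (AffineMap.lineMap (f p) (f q))]
    exact congrArg Set.range (funext (hline p q))
  refine ⟨hbij, fun l => ?_⟩
  -- With the image on the left, surjectivity lets its two base points be written as f p and f q.
  rw [iff_comm, mem_lines_iff hη, mem_lines_iff hη]
  rw [hbij.2.exists]
  refine exists_congr fun p => ?_
  rw [hbij.2.exists]
  refine exists_congr fun q => ?_
  rw [hbij.1.ne_iff, hf, ← himg, hbij.1.image_injective.eq_iff, mul_eq_zero_iff_left hα,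
    EmbeddingLike.map_eq_zero_iff]

end Lines

end SymplecticAps

open SymplecticAps in
theorem mainTheorem12 {F : Type*} [Field F] (hF : (2 : F) ≠ 0)
    {V : Type*} [AddCommGroup V] [Module F V] [FiniteDimensional F V] [Nontrivial V]
    (η : LinearMap.BilinForm F V) (hη : η.IsAlt) (hη' : η.Nondegenerate)
    (f : F × V → F × V) :
    [SymplecticAps.IsAutEquidist η f,
      SymplecticAps.IsAutAps η f,
      ∃ (α : F) (σ : F ≃+* F), α ≠ 0 ∧
        ∀ p₁ p₂ : F × V,
          SymplecticAps.rho η (f p₁) (f p₂) = α * σ (SymplecticAps.rho η p₁ p₂)].TFAE := by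
  tfae_have 3 → 2 := fun ⟨_, σ, hα, hf⟩ => isAutAps_of_rho_eq hη hη' hα σ hf
  tfae_have 2 → 3 := fun h => exists_rho_eq_of_neighbours hη hη' h.1 (h.rho_eq_zero_iff hη)
  tfae_have 3 → 1 := fun ⟨_, σ, hα, hf⟩ =>
    ⟨bijective_of_rho_eq hη hη' hα σ hf, fun p₁ p₂ p₃ p₄ => by
      rw [Equidist, Equidist, hf, hf, mul_right_inj' hα, σ.injective.eq_iff]⟩
  tfae_have 1 → 3 := fun h => exists_rho_eq_of_neighbours hη hη' h.1 fun p q => by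
    simpa only [Equidist, rho_self hη] using h.2 p q p p
  tfae_finish
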